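/- Let $n\ge 1$. For $1\le i\le n-1$ let $s_i=(i,\,i+1)\in S_n$ act on $\mathbb{C}[x_1,\dots,x_n]$ by exchanging $x_i$ and $x_{i+1}$, and let $$\partial_i f=\frac{s_i f-f}{x_{i+1}-x_i}.$$ For parameters $\alpha,\beta,\gamma$ let $$T_i^{(\beta,\alpha,\gamma)}=-\beta+\bigl((\alpha+\beta+\gamma)x_i+\gamma x_{i+1}+1+(\beta+\gamma)(\alpha+\gamma)x_ix_{i+1}\bigr)\partial_i .$$ For $w\in S_n$ and a partition $\lambda=(\lambda_1\ge\dots\ge\lambda_n)$, the twisted Kirillov polynomial is $$\mathcal{KN}_w^{(\beta,\alpha,\gamma)}(\boldsymbol{x};\lambda)=T_{i_1}^{(\beta,\alpha,\gamma)}T_{i_2}^{(\beta,\alpha,\gamma)}\cdots T_{i_\ell}^{(\beta,\alpha,\gamma)}\bigl(x_1^{d_1}\cdots x_n^{d_n}\bigr),\qquad d_i=\lambda_1-\lambda_{n+1-i}+n-i,$$ where $w=s_{i_1}s_{i_2}\cdots s_{i_\ell}$ is any reduced word. The Di Francesco–Zinn-Justin polynomial of $w$ is the specialization $\beta=\alpha=1$,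 $\gamma=0$, $\lambda=\boldsymbol{0}$: $$\mathcal{DZ}_w(\boldsymbol{x})=\mathcal{KN}_w^{(1,1,0)}(\boldsymbol{x};\boldsymbol{0}).$$ Then for every $n\ge 1$ and every $w\in S_n$, the polynomial $\mathcal{DZ}_w(\boldsymbol{x})$ does not depend on the choice of the reduced word of $w$, and all of its coefficients are non-negative integers. -/

import Mathlib

open MvPolynomial

/-- The exchange of the variables `x i` and `x (i+1)` in a polynomial in `n + 1` variables
(variables are indexed by `Fin (n + 1)`, positions of adjacent pairs by `Fin n`). -/
noncomputable def exchangeVars {R : Type*} [CommRing R] {n : ℕ} (i : Fin n)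
    (f : MvPolynomial (Fin (n + 1)) R) : MvPolynomial (Fin (n + 1)) R :=
  rename (Equiv.swap i.castSucc i.succ) f

/-- The division in the divided difference is exact. -/
theorem sub_dvd_exchangeVars_sub {R : Type*} [CommRing R] {n : ℕ} (i : Fin n)
    (f : MvPolynomial (Fin (n + 1)) R) :
    (X i.succ - X i.castSucc : MvPolynomial (Fin (n + 1)) R) ∣ exchangeVars i f - f := by
  unfold exchangeVars
  induction f using MvPolynomial.induction_on with
  | C a => simp
  | add p q hp hq =>
    have h := dvd_add hp hq
    rw [map_add]
    convert h using 1
    ring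
  | mul_X p k hp =>
    rw [map_mul, rename_X]
    have hk : (X i.succ - X i.castSucc : MvPolynomial (Fin (n + 1)) R) ∣
        X (Equiv.swap i.castSucc i.succ k) - X k := by
      by_cases h1 : k = i.castSucc
      · subst h1
        rw [Equiv.swap_apply_left]
      · by_cases h2 : k = i.succ
        · subst h2
          rw [Equiv.swap_apply_right]
          exact ⟨-1, by ring⟩
        · rw [Equiv.swap_apply_of_ne_of_ne h1 h2, sub_self]
          exact dvd_zero _
    have h := dvd_add (hp.mul_right (X k))
      (hk.mul_left (rename (Equiv.swap i.castSucc i.succ) p))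
    convert h using 1
    ring

/-- The divided difference `∂ i f = (s_i f - f) / (x (i+1) - x i)`, the quotient polynomial. -/
noncomputable def dividedDiff {R : Type*} [CommRing R] {n : ℕ} (i : Fin n)
    (f : MvPolynomial (Fin (n + 1)) R) : MvPolynomial (Fin (n + 1)) R :=
  Classical.choose (sub_dvd_exchangeVars_sub i f)

theorem sub_mul_dividedDiff {R : Type*} [CommRing R] {n : ℕ} (i : Fin n)
    (f : MvPolynomial (Fin (n + 1)) R) :
    (X i.succ - X i.castSucc) * dividedDiff i f = exchangeVars i f - f :=
  (Classical.choose_spec (sub_dvd_exchangeVars_sub i f)).symm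

/-- The quotient is the only polynomial with the defining property. -/
theorem dividedDiff_unique {R : Type*} [CommRing R] [IsDomain R] {n : ℕ} (i : Fin n)
    (f g : MvPolynomial (Fin (n + 1)) R)
    (h : (X i.succ - X i.castSucc) * g = exchangeVars i f - f) : g = dividedDiff i f := by
  have hne : (X i.succ - X i.castSucc : MvPolynomial (Fin (n + 1)) R) ≠ 0 := by
    rw [sub_ne_zero]
    intro hX
    exact (Fin.castSucc_lt_succ (i := i)).ne' (X_injective hX)
  exact mul_left_cancel₀ hne (h.trans (sub_mul_dividedDiff i f).symm)

/-- The operator `-β + ((α+β+γ) x_i + γ x_{i+1} + 1 + (β+γ)(α+γ) x_i x_{i+1}) ∂_i`. -/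
noncomputable def kirillovOp {R : Type*} [CommRing R] {n : ℕ} (β α γ : R) (i : Fin n)
    (f : MvPolynomial (Fin (n + 1)) R) : MvPolynomial (Fin (n + 1)) R :=
  -(C β * f) +
    (C (α + β + γ) * X i.castSucc + C γ * X i.succ + 1 +
      C ((β + γ) * (α + γ)) * X i.castSucc * X i.succ) * dividedDiff i f

/-- The composite `T_{i_1} ∘ T_{i_2} ∘ ⋯ ∘ T_{i_ℓ}` for the word `[i_1, i_2, …, i_ℓ]`. -/
noncomputable def kirillovWordOp {R : Type*} [CommRing R] {n : ℕ} (β α γ : R)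
    (l : List (Fin n)) (f : MvPolynomial (Fin (n + 1)) R) : MvPolynomial (Fin (n + 1)) R :=
  l.foldr (kirillovOp β α γ) f

/-- The product `s_{i_1} s_{i_2} ⋯ s_{i_ℓ}` of simple transpositions. -/
def simpleWordProd {n : ℕ} (l : List (Fin n)) : Equiv.Perm (Fin (n + 1)) :=
  (l.map fun i => Equiv.swap i.castSucc i.succ).prod

/-- `l` is a reduced word of `w`: a word with product `w` of the least possible length. -/
def IsReducedWord {n : ℕ} (w : Equiv.Perm (Fin (n + 1))) (l : List (Fin n)) : Prop :=
  simpleWordProd l = w ∧ ∀ l' : List (Fin n), simpleWordProd l' = w → l.length ≤ l'.length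

theorem exists_isReducedWord {n : ℕ} (w : Equiv.Perm (Fin (n + 1))) :
    ∃ l, IsReducedWord w l := by
  classical
  have hex : ∃ l : List (Fin n), simpleWordProd l = w := by
    have hw : w ∈ Submonoid.closure
        (Set.range fun i : Fin n => Equiv.swap i.castSucc i.succ) := by
      rw [Equiv.Perm.mclosure_swap_castSucc_succ]
      trivial
    induction hw using Submonoid.closure_induction with
    | mem x hx =>
      obtain ⟨i, rfl⟩ := hx
      exact ⟨[i], by simp [simpleWordProd]⟩
    | one => exact ⟨[], by simp [simpleWordProd]⟩
    | mul x y _ _ hx hy =>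
      obtain ⟨l, hl⟩ := hx
      obtain ⟨l', hl'⟩ := hy
      refine ⟨l ++ l', ?_⟩
      rw [← hl, ← hl']
      simp [simpleWordProd]
  have hlen : ∃ k : ℕ, ∃ l : List (Fin n), l.length = k ∧ simpleWordProd l = w := by
    obtain ⟨l, hl⟩ := hex
    exact ⟨l.length, l, rfl, hl⟩
  obtain ⟨l, hl, hlw⟩ := Nat.find_spec hlen
  refine ⟨l, hlw, fun l' hl' => ?_⟩
  rw [hl]
  exact Nat.find_min' hlen ⟨l', rfl, hl'⟩

/-- The seed monomial `x^d`, where in one-based indices and with `N = n + 1` variables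
`d_i = lam_1 - lam_{N+1-i} + N - i`. In zero-based indices both `N+1-i` and the number `N - i`
are `Fin.rev i`. The subtraction is exact since `lam` is weakly decreasing. -/
noncomputable def kirillovSeed (R : Type*) [CommRing R] {n : ℕ} (lam : Fin (n + 1) → ℕ) :
    MvPolynomial (Fin (n + 1)) R :=
  ∏ i : Fin (n + 1), X i ^ (lam 0 - lam i.rev + (i.rev : ℕ))

/-- The twisted Kirillov polynomial of `w` in the symmetric group on `n + 1` letters and of a
partition `lam` with `n + 1` parts, computed with some reduced word of `w`. -/
noncomputable def twistedKirillov {R : Type*} [CommRing R] {n : ℕ} (β α γ : R)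
    (w : Equiv.Perm (Fin (n + 1))) (lam : Fin (n + 1) → ℕ) (_hlam : Antitone lam) :
    MvPolynomial (Fin (n + 1)) R :=
  kirillovWordOp β α γ (Classical.choose (exists_isReducedWord w)) (kirillovSeed R lam)

/-- The Di Francesco–Zinn-Justin polynomial of `w`: parameters `β = α = 1`, `γ = 0` and the
zero partition. -/
noncomputable def diFrancescoZinnJustin {n : ℕ} (w : Equiv.Perm (Fin (n + 1))) :
    MvPolynomial (Fin (n + 1)) ℂ :=
  twistedKirillov 1 1 0 w (fun _ => 0) antitone_const

/-! ### A coloured lattice model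

A row of the model is a list of vertical edges, column `0` first; every edge is empty (`none`) or
carries a colour. A path enters at column `0` with the horizontal state `h`, and at each column
it either crosses the vertical edge or is exchanged with it. -/

/-! The operators become permutations of colours in a lattice model with one row per variable. The
Yang–Baxter equation `twoRowSum_exchange`, closed by empty edges on the left and by the colours `i +
1`, `i` on the right, yields `latticeSum_swap`: exchanging the colours `i` and `i + 1` at the top
applies the operator `T_i` to the partition function (`kirillovOp_latticeSum`). Descending top
colours freeze the lattice and give the seed monomial (`latticeSum_descendingColors`). Hence any
word, reduced or not, produces the partition function whose top colours are permuted by the product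
of the word, which depends on `w` alone.

Positivity is read off the weights. The only negative one, `-1`, belongs to an empty crossing, which
has the same edges as the empty turn of weight `1 + x`; together they contribute `x` (`rowSum_mem`).
-/

/-- The weight of a vertex whose horizontal edge crosses the vertical edge. -/
def crossWeight {A κ : Type*} [CommRing A] : Option κ → Option κ → A
  | none, none => -1
  | _, _ => 1

/-- The weight of a vertex that exchanges the horizontal and the vertical edge. -/
def turnWeight {A κ : Type*} [CommRing A] (x : A) : Option κ → Option κ → A
  | none, none => 1 + x
  | none, some _ => 1
  | some _, none => (1 + x) ^ 2
  | some _, some _ => 1 + x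

/-- The sum over all configurations of a row with spectral parameter `x`, entering horizontal
edge `h` and given top edges, of the weight times the value of `Φ` at the bottom edges and the
outgoing horizontal edge. -/
def rowSum {A κ : Type*} [CommRing A] (x : A) :
    Option κ → List (Option κ) → (List (Option κ) → Option κ → A) → A
  | h, [], Φ => Φ [] h
  | h, t :: ts, Φ =>
      crossWeight h t * rowSum x h ts (fun bs o => Φ (t :: bs) o) +
        turnWeight x h t * rowSum x t ts (fun bs o => Φ (h :: bs) o)

/-! ### One and two rows: recolouring, positivity, Yang–Baxter. -/

section rowSum

variable {A κ : Type*} [CommRing A]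

theorem rowSum_add (x : A) (h : Option κ) (ts : List (Option κ))
    (Φ Ψ : List (Option κ) → Option κ → A) :
    rowSum x h ts (fun b o => Φ b o + Ψ b o) = rowSum x h ts Φ + rowSum x h ts Ψ := by
  induction ts generalizing h Φ Ψ with
  | nil => rfl
  | cons t ts ih =>
    simp only [rowSum, ih]
    ring

theorem rowSum_mul (x a : A) (h : Option κ) (ts : List (Option κ))
    (Φ : List (Option κ) → Option κ → A) :
    rowSum x h ts (fun b o => a * Φ b o) = a * rowSum x h ts Φ := by
  induction ts generalizing h Φ with
  | nil => rfl
  | cons t ts ih =>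
    simp only [rowSum, ih]
    ring

/-- The weights see only whether an edge is occupied, never its colour. -/
theorem rowSum_map (x : A) (e : κ → κ) (h : Option κ) (ts : List (Option κ))
    (Φ : List (Option κ) → Option κ → A) :
    rowSum x (h.map e) (ts.map (Option.map e)) Φ =
      rowSum x h ts (fun b o => Φ (b.map (Option.map e)) (o.map e)) := by
  induction ts generalizing h Φ with
  | nil => rfl
  | cons t ts ih =>
    simp only [rowSum, List.map_cons, ih]
    cases h <;> cases t <;> rfl

theorem map_rowSum {B : Type*} [CommRing B] (f : A →+* B) (x : A) (h : Option κ)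
    (ts : List (Option κ)) (Φ : List (Option κ) → Option κ → A) :
    f (rowSum x h ts Φ) = rowSum (f x) h ts (fun b o => f (Φ b o)) := by
  induction ts generalizing h Φ with
  | nil => rfl
  | cons t ts ih =>
    simp only [rowSum, map_add, map_mul, ih]
    cases h <;> cases t <;> simp [crossWeight, turnWeight]

theorem rowSum_mem (S : Subsemiring A) {x : A} (hx : x ∈ S) (h : Option κ)
    (ts : List (Option κ)) (Φ : List (Option κ) → Option κ → A) (hΦ : ∀ b o, Φ b o ∈ S) :
    rowSum x h ts Φ ∈ S := by
  induction ts generalizing h Φ with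
  | nil => exact hΦ _ _
  | cons t ts ih =>
    have hx1 : 1 + x ∈ S := S.add_mem S.one_mem hx
    have h1 := ih h (fun bs o => Φ (t :: bs) o) fun _ _ => hΦ _ _
    have h2 := ih t (fun bs o => Φ (h :: bs) o) fun _ _ => hΦ _ _
    rcases h with _ | c <;> rcases t with _ | d <;>
      simp only [rowSum, crossWeight, turnWeight, one_mul]
    -- Crossing and turning coincide on two empty edges, so the weights add up to `-1 + (1 + x) =
    -- x`.
    · rw [← add_mul]
      simpa using S.mul_mem hx h1
    · exact S.add_mem h1 h2
    · exact S.add_mem h1 (S.mul_mem (S.pow_mem hx1 2) h2)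
    · exact S.add_mem h1 (S.mul_mem hx1 h2)

/-- Two consecutive rows, the upper one with parameter `y` and the lower one with `x`. -/
def twoRowSum (y x : A) (h₁ h₂ : Option κ) (ts : List (Option κ))
    (Φ : List (Option κ) → Option κ → Option κ → A) : A :=
  rowSum y h₁ ts fun mid o₁ => rowSum x h₂ mid fun b o₂ => Φ b o₁ o₂

theorem twoRowSum_cons (y x : A) (h₁ h₂ t : Option κ) (ts : List (Option κ))
    (Φ : List (Option κ) → Option κ → Option κ → A) :
    twoRowSum y x h₁ h₂ (t :: ts) Φ =
      crossWeight h₁ t *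
          (crossWeight h₂ t * twoRowSum y x h₁ h₂ ts (fun b => Φ (t :: b)) +
            turnWeight x h₂ t * twoRowSum y x h₁ t ts (fun b => Φ (h₂ :: b))) +
        turnWeight y h₁ t *
          (crossWeight h₂ h₁ * twoRowSum y x t h₂ ts (fun b => Φ (h₁ :: b)) +
            turnWeight x h₂ h₁ * twoRowSum y x t h₁ ts (fun b => Φ (h₂ :: b))) := by
  simp only [twoRowSum, rowSum, rowSum_add, rowSum_mul]

theorem twoRowSum_add (y x : A) (h₁ h₂ : Option κ) (ts : List (Option κ))
    (Φ Ψ : List (Option κ) → Option κ → Option κ → A) :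
    twoRowSum y x h₁ h₂ ts (fun b o₁ o₂ => Φ b o₁ o₂ + Ψ b o₁ o₂) =
      twoRowSum y x h₁ h₂ ts Φ + twoRowSum y x h₁ h₂ ts Ψ := by
  simp only [twoRowSum, rowSum_add]

theorem twoRowSum_mul (y x a : A) (h₁ h₂ : Option κ) (ts : List (Option κ))
    (Φ : List (Option κ) → Option κ → Option κ → A) :
    twoRowSum y x h₁ h₂ ts (fun b o₁ o₂ => a * Φ b o₁ o₂) = a * twoRowSum y x h₁ h₂ ts Φ := by
  simp only [twoRowSum, rowSum_mul]

/-- The diagonal part of the intertwiner of two horizontal lines. -/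
def intertwinerDiag (y x : A) : Option κ → Option κ → A
  | none, some _ => (1 + x) ^ 2
  | some _, none => (1 + y) ^ 2
  | _, _ => (1 + x) * (1 + y)

/-- The Yang–Baxter equation, propagated through all columns. -/
theorem twoRowSum_exchange (y x : A) (h₁ h₂ : Option κ) (ts : List (Option κ))
    (Φ : List (Option κ) → Option κ → Option κ → A) :
    twoRowSum y x h₁ h₂ ts (fun b o₁ o₂ => intertwinerDiag y x o₁ o₂ * Φ b o₁ o₂ +
        (y - x) * (crossWeight o₁ o₂ * Φ b o₂ o₁)) =
      intertwinerDiag y x h₁ h₂ * twoRowSum x y h₁ h₂ ts Φ +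
        (y - x) * (crossWeight h₁ h₂ * twoRowSum x y h₂ h₁ ts Φ) := by
  induction ts generalizing h₁ h₂ Φ with
  | nil => rfl
  | cons t ts ih =>
    have ih' : ∀ (k₁ k₂ c : Option κ), twoRowSum y x k₁ k₂ ts
        (fun b o₁ o₂ => intertwinerDiag y x o₁ o₂ * Φ (c :: b) o₁ o₂ +
          (y - x) * (crossWeight o₁ o₂ * Φ (c :: b) o₂ o₁)) = _ :=
      fun k₁ k₂ c => ih k₁ k₂ fun b => Φ (c :: b)
    simp only [twoRowSum_cons, ih']
    -- Since crossing and turning are summed even when the edges agree, no colours need comparing: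
    -- eight empty/occupied patterns suffice.
    cases h₁ <;> cases h₂ <;> cases t <;>
      simp only [intertwinerDiag, crossWeight, turnWeight] <;> ring

end rowSum

/-! ### Partition functions and the exchange relation. -/

/-- The partition function of `m` rows with parameters `x (m - 1), …, x 0` from top to bottom;
in the row with parameter `x j` the colour `j` leaves the lattice. -/
def latticeSum {A : Type*} [CommRing A] (x : ℕ → A) : ℕ → List (Option ℕ) → A
  | 0, _ => 1
  | m + 1, ts => rowSum (x m) none ts fun b o => if o = some m then latticeSum x m b else 0

section latticeSum

variable {A : Type*} [CommRing A]

theorem map_latticeSum {B : Type*} [CommRing B] (f : A →+* B) (x : ℕ → A) (m : ℕ)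
    (ts : List (Option ℕ)) : f (latticeSum x m ts) = latticeSum (fun j => f (x j)) m ts := by
  induction m generalizing ts with
  | zero => simp [latticeSum]
  | succ m ih => simp only [latticeSum, map_rowSum, apply_ite f, ih, map_zero]

theorem latticeSum_congr {x x' : ℕ → A} {m : ℕ} (hx : ∀ j < m, x j = x' j)
    (ts : List (Option ℕ)) : latticeSum x m ts = latticeSum x' m ts := by
  induction m generalizing ts with
  | zero => rfl
  | succ m ih =>
    simp only [latticeSum, hx m m.lt_succ_self, ih fun j hj => hx j (hj.trans m.lt_succ_self)]

theorem latticeSum_mem (S : Subsemiring A) {x : ℕ → A} (hx : ∀ j, x j ∈ S) (m : ℕ)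
    (ts : List (Option ℕ)) : latticeSum x m ts ∈ S := by
  induction m generalizing ts with
  | zero => exact S.one_mem
  | succ m ih =>
    refine rowSum_mem S (hx m) _ _ _ fun b o => ?_
    split_ifs
    · exact ih b
    · exact S.zero_mem

/-- Recolouring by a permutation `e` changes the colour that has to leave a row. -/
theorem latticeSum_succ_map (x : ℕ → A) (m : ℕ) (e : Equiv.Perm ℕ) (ts : List (Option ℕ)) :
    latticeSum x (m + 1) (ts.map (Option.map e)) = rowSum (x m) none ts fun b o =>
      if o = some (e.symm m) then latticeSum x m (b.map (Option.map e)) else 0 := by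
  have hr := rowSum_map (x m) e none ts fun b o => if o = some m then latticeSum x m b else 0
  rw [Option.map_none] at hr
  rw [latticeSum, hr]
  congr 1
  funext b o
  refine if_congr ?_ rfl rfl
  rcases o with _ | o <;> simp [Equiv.eq_symm_apply]

/-- The colours `≥ m` play no role in a lattice of `m` rows. -/
theorem latticeSum_map_of_fix (x : ℕ → A) {m : ℕ} (e : Equiv.Perm ℕ) (he : ∀ j < m, e j = j)
    (ts : List (Option ℕ)) : latticeSum x m (ts.map (Option.map e)) = latticeSum x m ts := by
  induction m generalizing ts with
  | zero => rfl
  | succ m ih =>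
    have hm : e.symm m = m := by rw [Equiv.symm_apply_eq, he m m.lt_succ_self]
    rw [latticeSum_succ_map, hm, latticeSum]
    simp only [ih fun j hj => he j (hj.trans m.lt_succ_self)]

/-- The exchange relation for two adjacent colours and the two adjacent parameters. -/
theorem latticeSum_swap (x : ℕ → A) {i m : ℕ} (him : i + 1 < m) (ts : List (Option ℕ)) :
    (x (i + 1) - x i) * (latticeSum x m (ts.map (Option.map (Equiv.swap i (i + 1)))) +
        latticeSum x m ts) =
      (1 + 2 * x i + x i * x (i + 1)) *
        (latticeSum (fun j => x (Equiv.swap i (i + 1) j)) m ts - latticeSum x m ts) := by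
  induction m, him using Nat.le_induction generalizing ts with
  | base =>
    set Φ : List (Option ℕ) → Option ℕ → Option ℕ → A := fun b o₁ o₂ =>
      if o₁ = some (i + 1) then if o₂ = some i then latticeSum x i b else 0 else 0 with hΦ
    have hlow : ∀ b, latticeSum (fun j => x (Equiv.swap i (i + 1) j)) i b = latticeSum x i b :=
      latticeSum_congr fun j hj => by
        rw [Equiv.swap_apply_of_ne_of_ne (by omega) (by omega)]
    have hrow0 : ∀ (z : A) (h : Option ℕ) (l : List (Option ℕ)),
        rowSum z h l (fun _ _ => (0 : A)) = 0 := fun z h l => by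
      simpa using rowSum_mul z 0 h l fun _ _ => 0
    have hZ : ∀ x' : ℕ → A, latticeSum x' (i + 2) ts =
        twoRowSum (x' (i + 1)) (x' i) none none ts fun b o₁ o₂ =>
          if o₁ = some (i + 1) then if o₂ = some i then latticeSum x' i b else 0 else 0 := by
      intro x'
      simp only [twoRowSum, latticeSum]
      congr! 3 with b o
      split_ifs <;> simp [hrow0]
    have h1 : latticeSum x (i + 2) ts = twoRowSum (x (i + 1)) (x i) none none ts Φ := hZ x
    have h2 : latticeSum (fun j => x (Equiv.swap i (i + 1) j)) (i + 2) ts =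
        twoRowSum (x i) (x (i + 1)) none none ts Φ := by
      rw [hZ]
      simp only [hlow, Equiv.swap_apply_left, Equiv.swap_apply_right, hΦ]
    -- Exchanging the colours at the top amounts to exchanging the exits of the two rows; the rows
    -- below see neither colour.
    have h3 : latticeSum x (i + 2) (ts.map (Option.map (Equiv.swap i (i + 1)))) =
        twoRowSum (x (i + 1)) (x i) none none ts fun b o₁ o₂ => Φ b o₂ o₁ := by
      rw [latticeSum_succ_map]
      simp only [twoRowSum, latticeSum_succ_map, Equiv.symm_swap, Equiv.swap_apply_left,
        Equiv.swap_apply_right, hΦ]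
      congr! 3 with b o
      split_ifs with ho
      · congr! 4
        exact latticeSum_map_of_fix x _
          (fun j hj => Equiv.swap_apply_of_ne_of_ne (by omega) (by omega)) _
      · simp [hrow0]
    -- With `x = x i` and `y = x (i + 1)`, the occupied exits give `(1 + x) * (1 + y)` and `y - x`.
    -- The empty entrances give `(1 + x) * (1 + y) - (y - x) = 1 + 2 * x + x * y`, the factor in the
    -- operator.
    have hR := twoRowSum_exchange (x (i + 1)) (x i) none none ts Φ
    have hR' : (fun b o₁ o₂ => intertwinerDiag (x (i + 1)) (x i) o₁ o₂ * Φ b o₁ o₂ +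
        (x (i + 1) - x i) * (crossWeight o₁ o₂ * Φ b o₂ o₁)) = fun b o₁ o₂ =>
        (1 + x i) * (1 + x (i + 1)) * Φ b o₁ o₂ + (x (i + 1) - x i) * Φ b o₂ o₁ := by
      funext b o₁ o₂
      rcases o₁ with _ | o₁ <;> rcases o₂ with _ | o₂ <;>
        simp [hΦ, intertwinerDiag, crossWeight]
    rw [hR', twoRowSum_add, twoRowSum_mul, twoRowSum_mul] at hR
    simp only [intertwinerDiag, crossWeight] at hR
    rw [h1, h2, h3]
    linear_combination hR
  | succ m hm ih =>
    -- The new top row keeps its parameter and its exit colour, so the relation passes through it by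
    -- linearity.
    have hfix : Equiv.swap i (i + 1) m = m :=
      Equiv.swap_apply_of_ne_of_ne (by omega) (by omega)
    rw [latticeSum_succ_map]
    simp only [latticeSum, Equiv.symm_swap, hfix]
    rw [sub_eq_add_neg, sub_eq_add_neg _ (rowSum _ _ _ _), neg_eq_neg_one_mul (rowSum _ _ _ _)]
    simp only [← rowSum_mul, ← rowSum_add]
    congr! 3 with b o
    split_ifs
    · linear_combination ih b
    · ring

/-! ### The frozen lattice of the seed. -/

theorem rowSum_eq_zero_of_notMem (x : A) {h : Option ℕ} {ts : List (Option ℕ)} {c : ℕ}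
    (hh : h ≠ some c) (hts : some c ∉ ts) (f : List (Option ℕ) → A) :
    rowSum x h ts (fun b o => if o = some c then f b else 0) = 0 := by
  induction ts generalizing h f with
  | nil => simp [rowSum, hh]
  | cons t ts ih =>
    rw [List.mem_cons, not_or] at hts
    rw [rowSum, ih hh hts.2 fun b => f (t :: b), ih (Ne.symm hts.1) hts.2 fun b => f (h :: b)]
    ring

theorem rowSum_of_exit (x : A) {ts : List (Option ℕ)} {c : ℕ} (hts : some c ∉ ts)
    (f : List (Option ℕ) → A) (hsome : ∀ t ∈ ts, t ≠ none) :
    rowSum x (some c) ts (fun b o => if o = some c then f b else 0) = f ts := by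
  induction ts generalizing f with
  | nil => simp [rowSum]
  | cons t ts ih =>
    rw [List.mem_cons, not_or] at hts
    rw [rowSum, rowSum_eq_zero_of_notMem x (Ne.symm hts.1) hts.2 fun b => f (some c :: b),
      ih hts.2 (fun b => f (t :: b)) fun s hs => hsome s (List.mem_cons_of_mem _ hs)]
    simp [crossWeight]

/-- The top edges carrying the colours `m - 1, …, 0` in this order. -/
def descendingColors : ℕ → List (Option ℕ)
  | 0 => []
  | m + 1 => some m :: descendingColors m

theorem mem_descendingColors {m : ℕ} {t : Option ℕ} (ht : t ∈ descendingColors m) :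
    ∃ j < m, t = some j := by
  induction m with
  | zero => simp [descendingColors] at ht
  | succ m ih =>
    rcases List.mem_cons.1 ht with rfl | ht
    · exact ⟨m, m.lt_succ_self, rfl⟩
    · obtain ⟨j, hj, rfl⟩ := ih ht
      exact ⟨j, hj.trans m.lt_succ_self, rfl⟩

/-- Each leading empty column contributes `x`. The path must then pick up colour `m` in its column
and carry it across all the others, since a colour left on a vertical edge cannot exit. Its column
becomes empty, so the empty block grows by one. -/
theorem rowSum_descendingColors (x : A) (m k : ℕ) (f : List (Option ℕ) → A) :
    rowSum x none (List.replicate k none ++ descendingColors (m + 1))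
        (fun b o => if o = some m then f b else 0) =
      x ^ k * f (List.replicate (k + 1) none ++ descendingColors m) := by
  have hmem : some m ∉ descendingColors m := fun h => by
    obtain ⟨j, hj, he⟩ := mem_descendingColors h
    exact hj.ne' (Option.some_injective _ he)
  induction k generalizing f with
  | zero =>
    have hsome : ∀ t ∈ descendingColors m, t ≠ none := fun t ht => by
      obtain ⟨j, -, rfl⟩ := mem_descendingColors ht
      simp
    simp only [List.replicate_zero, List.nil_append, descendingColors, rowSum]
    rw [rowSum_eq_zero_of_notMem x (by simp) hmem fun b => f (some m :: b),
      rowSum_of_exit x hmem (fun b => f (none :: b)) hsome]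
    simp [turnWeight]
  | succ k ih =>
    rw [List.replicate_succ, List.cons_append, rowSum, ih fun b => f (none :: b)]
    simp only [crossWeight, turnWeight, List.replicate_succ, List.cons_append]
    ring

theorem latticeSum_descendingColors (x : ℕ → A) (m k : ℕ) :
    latticeSum x m (List.replicate k none ++ descendingColors m) =
      ∏ j ∈ Finset.range m, x j ^ (k + (m - 1 - j)) := by
  induction m generalizing k with
  | zero => simp [latticeSum]
  | succ m ih =>
    rw [latticeSum, rowSum_descendingColors, ih, Finset.prod_range_succ, mul_comm]
    congr 1
    · refine Finset.prod_congr rfl fun j hj => ?_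
      rw [Finset.mem_range] at hj
      congr 1
      omega
    · simp

end latticeSum

/-! ### The operators acting on partition functions. -/

/-- The variables as row parameters, continued by zero. -/
noncomputable def rowVar (n : ℕ) (j : ℕ) : MvPolynomial (Fin (n + 1)) ℂ :=
  if h : j < n + 1 then X ⟨j, h⟩ else 0

theorem rowVar_val {n : ℕ} (j : Fin (n + 1)) : rowVar n j = X j := by
  simp [rowVar, j.isLt]

theorem swap_val {n : ℕ} (i : Fin n) (j : Fin (n + 1)) :
    ((Equiv.swap i.castSucc i.succ j : Fin (n + 1)) : ℕ) =
      Equiv.swap (i : ℕ) ((i : ℕ) + 1) (j : ℕ) := by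
  have h := (Fin.val_injective (n := n + 1)).swap_apply i.castSucc i.succ j
  simpa using h.symm

theorem exchangeVars_latticeSum {n : ℕ} (i : Fin n) (ts : List (Option ℕ)) :
    exchangeVars i (latticeSum (rowVar n) (n + 1) ts) =
      latticeSum (fun j => rowVar n (Equiv.swap (i : ℕ) ((i : ℕ) + 1) j)) (n + 1) ts := by
  have h := map_latticeSum
    (rename (R := ℂ) (Equiv.swap i.castSucc i.succ)).toRingHom (rowVar n) (n + 1) ts
  refine h.trans (latticeSum_congr (fun j hj => ?_) ts)
  have h1 := rowVar_val (⟨j, hj⟩ : Fin (n + 1))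
  have h2 := rowVar_val (Equiv.swap i.castSucc i.succ ⟨j, hj⟩)
  rw [swap_val] at h2
  simp only at h1 h2 ⊢
  rw [h1, h2]
  simp

theorem kirillovOp_latticeSum {n : ℕ} (i : Fin n) (ts : List (Option ℕ)) :
    kirillovOp 1 1 0 i (latticeSum (rowVar n) (n + 1) ts) =
      latticeSum (rowVar n) (n + 1)
        (ts.map (Option.map (Equiv.swap (i : ℕ) ((i : ℕ) + 1)))) := by
  have hne : (X i.succ - X i.castSucc : MvPolynomial (Fin (n + 1)) ℂ) ≠ 0 := by
    rw [sub_ne_zero]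
    exact fun hX => (Fin.castSucc_lt_succ (i := i)).ne' (X_injective hX)
  have hs := latticeSum_swap (rowVar n) (i := i) (m := n + 1) (by omega) ts
  have hd := sub_mul_dividedDiff i (latticeSum (rowVar n) (n + 1) ts)
  have h1 := rowVar_val i.castSucc
  have h2 := rowVar_val i.succ
  rw [Fin.val_castSucc] at h1
  rw [Fin.val_succ] at h2
  rw [← exchangeVars_latticeSum, h1, h2] at hs
  refine mul_left_cancel₀ hne ?_
  have hC : (C (1 + 1) : MvPolynomial (Fin (n + 1)) ℂ) = 2 := by
    rw [one_add_one_eq_two]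
    exact map_ofNat C 2
  simp only [kirillovOp, add_zero, hC, mul_one, map_one, map_zero]
  linear_combination (1 + 2 * X i.castSucc + X i.castSucc * X i.succ) * hd - hs

/-- Prepending `i` applies `T_i` last and multiplies the product by `s_i` on the left, which acts on
the colours. The `rev` makes the empty word give descending colours. -/
theorem kirillovWordOp_seed {n : ℕ} (l : List (Fin n)) :
    kirillovWordOp 1 1 0 l (kirillovSeed ℂ (fun _ => 0)) =
      latticeSum (rowVar n) (n + 1)
        (List.ofFn fun j : Fin (n + 1) => some ((simpleWordProd l j.rev : Fin (n + 1)) : ℕ)) := by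
  induction l with
  | nil =>
    have hlist : ∀ m : ℕ, (List.ofFn fun j : Fin m => some ((j.rev : Fin m) : ℕ)) =
        descendingColors m := by
      intro m
      induction m with
      | zero => rfl
      | succ m ih =>
        rw [List.ofFn_succ, descendingColors, ← ih]
        simp [Fin.rev_succ]
    have h := latticeSum_descendingColors (rowVar n) (n + 1) 0
    rw [List.replicate_zero, List.nil_append, ← hlist, Finset.prod_range] at h
    simp only [simpleWordProd, List.map_nil, List.prod_nil, Equiv.Perm.one_apply]
    rw [h]
    simp only [kirillovWordOp, List.foldr_nil, kirillovSeed, rowVar_val]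
    refine Finset.prod_congr rfl fun j _ => ?_
    congr 1
    rw [Fin.val_rev]
    omega
  | cons i l ih =>
    rw [kirillovWordOp, List.foldr_cons, ← kirillovWordOp, ih, kirillovOp_latticeSum,
      List.map_ofFn]
    congr 2
    funext j
    simp [simpleWordProd, swap_val]

/-- For every `n + 1 ≥ 1` and every permutation `w` of `n + 1` letters, the
Di Francesco–Zinn-Justin polynomial of `w` does not depend on the reduced word it is computed
with, and all its coefficients are non-negative integers. -/
theorem corollary5p5 (n : ℕ) (w : Equiv.Perm (Fin (n + 1))) :
    (∀ l : List (Fin n), IsReducedWord w l →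
      kirillovWordOp 1 1 0 l (kirillovSeed ℂ (fun _ => 0)) = diFrancescoZinnJustin w) ∧
    ∀ m : Fin (n + 1) →₀ ℕ, ∃ k : ℕ, (diFrancescoZinnJustin w).coeff m = (k : ℂ) := by
  have hw := (Classical.choose_spec (exists_isReducedWord w)).1
  have hDZ := kirillovWordOp_seed (Classical.choose (exists_isReducedWord w))
  rw [hw] at hDZ
  refine ⟨fun l hl => ?_, fun m => ?_⟩
  · rw [kirillovWordOp_seed, hl.1]
    exact hDZ.symm
  -- Polynomials with coefficients in `ℕ` form a subsemiring containing all row parameters.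
  · have hmem : diFrancescoZinnJustin w ∈
        (MvPolynomial.map (σ := Fin (n + 1)) (Nat.castRingHom ℂ)).rangeS := by
      rw [diFrancescoZinnJustin, twistedKirillov, hDZ]
      refine latticeSum_mem _ (fun j => ?_) _ _
      unfold rowVar
      split_ifs with h
      · exact ⟨X ⟨j, h⟩, map_X _ _⟩
      · exact Subsemiring.zero_mem _
    obtain ⟨p, hp⟩ := hmem
    exact ⟨p.coeff m, by rw [← hp, coeff_map]; rfl⟩
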